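/- **Setting.** Let $B\in\mathbb R^{N\times N}$ be symmetric positive definite, $B_0\in\mathbb R^{N\times N}$ symmetric, $0\neq s\in\mathbb R^N$ and $y=Bs$. For $c\in\mathbb R^N$ with $c^\top s\ne 0$ put $$D(c)=B_0+\frac{(y-B_0s)c^\top+c(y-B_0s)^\top}{c^\top s}-\frac{c\,s^\top(y-B_0s)\,c^\top}{(c^\top s)^2}.$$ The update rules are the matrices $D(c)$ with: $c=s$ (Powell symmetric Broyden, PSB); $c=y-B_0s$ (symmetric rank 1, SR1); $c=B_0s$ (Greenstadt); $c=y$ (DFP); $c=y+\sqrt{\tfrac{y^\top s}{s^\top B_0s}}\,B_0s$ (BFGS). For a symmetric $W$ that is definite (positive or negative), consider on the vectorized $N\times N$ matrices the Gaussian prior with mean $B_0$ and covariance $\Sigma_{ij,kl}=\tfrac12(W_{ik}W_{jl}+W_{jk}W_{il})$, which is positive semidefinite. The *one-step posterior mean for $W$* is the mean of the posterior after the single noise-free observation "(unknown matrix)$\,\cdot s=y$". This posterior is the weak limit, as the positive definite matrix $\Lambda$ tends to $0$, of the Bayes posteriors for the Gaussian likelihood $\mathcal N(y;Xs,\Lambda)$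 of a matrix $X$. **Statement.** For every real $\alpha\neq0$ the one-step posterior mean for $W$ exists and equals 1. the PSB update, if $W=\alpha I$; 2. the SR1 update, if $W=\alpha(B-B_0)$, provided that $B-B_0$ is definite; 3. the Greenstadt update, if $W=\alpha B_0$, provided that $B_0$ is definite; 4. the DFP update, if $W=\alpha B$; 5. the BFGS update, if $W=\alpha(B+\rho B_0)$ with $\rho=\sqrt{\tfrac{s^\top Bs}{s^\top B_0s}}$, provided that $s^\top B_0s>0$ and $B+\rho B_0$ is definite. Moreover, in cases 2, 4 and 5 let $V$ be $B-B_0$, $B$ and $B+\rho B_0$ respectively (in case 5, $\rho$ is the number determined by the given $s$). Then: * The symmetric matrices $W$ with $Ws=Vs$ form the affine space $V+\{D: D=D^\top,\ Ds=0\}$, and for $N\ge2$ this contains a definite $W\neq V$. For every definite $W$ in it and every $\alpha\ne0$, the one-step posterior mean for $\alpha W$ is the same update. * $V$ is the only globally consistent choice. A matrix $W$ satisfies $Wv=Vv$ for all $v\in\mathbb R^N$ if and only if $W=V$, and it satisfies $Wv\in\mathbb R\,Vv$ for all $v\in\mathbb R^N$ if and only if $W$ is a scalar multiple of $V$. -/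

import Mathlib

open MeasureTheory ProbabilityTheory Filter Topology Matrix

noncomputable section

namespace SecantInference

variable {N : ℕ}

/-- The space of vectorized `N × N` matrices, indexed by pairs `(i, j)`. -/
abbrev VecMat (N : ℕ) : Type := EuclideanSpace ℝ (Fin N × Fin N)

/-- Vectorization of a matrix. -/
def vect (A : Matrix (Fin N) (Fin N) ℝ) : VecMat N :=
  WithLp.toLp 2 (fun p => A p.1 p.2)

/-- The matrix with a given vectorization. -/
def unvect (v : VecMat N) : Matrix (Fin N) (Fin N) ℝ :=
  Matrix.of (fun i j => v (i, j))

/-- The symmetric Kronecker product of `W` with itself: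
its entry at `(ij, kl)` is `(W_ik W_jl + W_jk W_il) / 2`. -/
def symKron (W : Matrix (Fin N) (Fin N) ℝ) :
    Matrix (Fin N × Fin N) (Fin N × Fin N) ℝ :=
  Matrix.of (fun p q => (W p.1 q.1 * W p.2 q.2 + W p.2 q.1 * W p.1 q.2) / 2)

/-- The Gaussian prior on (vectorized) matrices, with mean `B₀` and covariance `symKron W`. -/
def matrixPrior (B₀ W : Matrix (Fin N) (Fin N) ℝ) : Measure (VecMat N) :=
  multivariateGaussian (vect B₀) (symKron W)

/-- The value at `x` of the Gaussian density on `ℝ^N` with mean `m` and covariance matrix `L`. -/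
def gaussianDensity (m : Fin N → ℝ) (L : Matrix (Fin N) (Fin N) ℝ) (x : Fin N → ℝ) : ℝ :=
  (Real.sqrt ((2 * Real.pi) ^ N * L.det))⁻¹ *
    Real.exp (-(1 / 2) * ((x - m) ⬝ᵥ (L⁻¹ *ᵥ (x - m))))

/-- The likelihood of the matrix with vectorization `v` when its product with `s` is observed to
be `y`, up to Gaussian noise of covariance `L`. -/
def likelihood (s y : Fin N → ℝ) (L : Matrix (Fin N) (Fin N) ℝ) (v : VecMat N) : ENNReal :=
  ENNReal.ofReal (gaussianDensity (unvect v *ᵥ s) L y)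

/-- Bayes' theorem: the posterior is the prior weighted by the likelihood and normalized. -/
def noisyPosterior (p : Measure (VecMat N)) (s y : Fin N → ℝ)
    (L : Matrix (Fin N) (Fin N) ℝ) : Measure (VecMat N) :=
  (∫⁻ v, likelihood s y L v ∂p)⁻¹ • p.withDensity (likelihood s y L)

/-- `q` is the posterior after the noise-free observation `B s = y`: it is the weak limit of the
posteriors under Gaussian observation noise, as the positive definite noise covariance tends
to zero. -/
def IsNoiseFreePosterior (p : Measure (VecMat N)) (s y : Fin N → ℝ)
    (q : Measure (VecMat N)) : Prop :=
  IsProbabilityMeasure q ∧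
    ∀ f : BoundedContinuousFunction (VecMat N) ℝ,
      Tendsto (fun L : Matrix (Fin N) (Fin N) ℝ => ∫ v, f v ∂(noisyPosterior p s y L))
        (𝓝[{L | L.PosDef}] 0) (𝓝 (∫ v, f v ∂q))

/-- `A` is the mean of the posterior that Gaussian regression, with prior mean `B₀` and prior
covariance `symKron W`, assigns after the single noise-free observation `B s = y`. The first
clause says that `symKron W` is indeed a covariance matrix. -/
def IsOneStepPosteriorMean (B₀ W : Matrix (Fin N) (Fin N) ℝ) (s y : Fin N → ℝ)
    (A : Matrix (Fin N) (Fin N) ℝ) : Prop :=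
  (symKron W).PosSemidef ∧
    ∃ q : Measure (VecMat N), IsNoiseFreePosterior (matrixPrior B₀ W) s y q ∧
      Integrable (fun v => v) q ∧ ∫ v, v ∂q = vect A

/-- The update of the Dennis class with parameter vector `c`. -/
def dennisUpdate (B₀ : Matrix (Fin N) (Fin N) ℝ) (s y c : Fin N → ℝ) :
    Matrix (Fin N) (Fin N) ℝ :=
  B₀ + (c ⬝ᵥ s)⁻¹ • (vecMulVec (y - B₀ *ᵥ s) c + vecMulVec c (y - B₀ *ᵥ s))
    - ((s ⬝ᵥ (y - B₀ *ᵥ s)) / (c ⬝ᵥ s) ^ 2) • vecMulVec c c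

/-- Powell symmetric Broyden. -/
def psbUpdate (B₀ : Matrix (Fin N) (Fin N) ℝ) (s y : Fin N → ℝ) : Matrix (Fin N) (Fin N) ℝ :=
  dennisUpdate B₀ s y s

/-- Symmetric rank 1. -/
def sr1Update (B₀ : Matrix (Fin N) (Fin N) ℝ) (s y : Fin N → ℝ) : Matrix (Fin N) (Fin N) ℝ :=
  dennisUpdate B₀ s y (y - B₀ *ᵥ s)

/-- Greenstadt. -/
def greenstadtUpdate (B₀ : Matrix (Fin N) (Fin N) ℝ) (s y : Fin N → ℝ) :
    Matrix (Fin N) (Fin N) ℝ :=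
  dennisUpdate B₀ s y (B₀ *ᵥ s)

/-- Davidon, Fletcher, Powell. -/
def dfpUpdate (B₀ : Matrix (Fin N) (Fin N) ℝ) (s y : Fin N → ℝ) : Matrix (Fin N) (Fin N) ℝ :=
  dennisUpdate B₀ s y y

/-- Broyden, Fletcher, Goldfarb, Shanno (as a direct update). -/
def bfgsUpdate (B₀ : Matrix (Fin N) (Fin N) ℝ) (s y : Fin N → ℝ) : Matrix (Fin N) (Fin N) ℝ :=
  dennisUpdate B₀ s y (y + Real.sqrt ((y ⬝ᵥ s) / (s ⬝ᵥ (B₀ *ᵥ s))) • (B₀ *ᵥ s))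

/-- `W` is positive definite or negative definite; both signs occur because `W` is
scaled by an arbitrary nonzero real, which leaves `symKron W` a covariance matrix. -/
def IsDefinite (W : Matrix (Fin N) (Fin N) ℝ) : Prop :=
  W.PosDef ∨ (-W).PosDef

/-- The symmetric matrices `W` with `W s = c`. -/
def choices (s c : Fin N → ℝ) : Set (Matrix (Fin N) (Fin N) ℝ) :=
  {W | W.IsSymm ∧ W *ᵥ s = c}

/-- The linear space of symmetric matrices that annihilate `s`. -/
def annihilators (s : Fin N → ℝ) : Submodule ℝ (Matrix (Fin N) (Fin N) ℝ) where
  carrier := {D | D.IsSymm ∧ D *ᵥ s = 0}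
  add_mem' := by
    rintro A C ⟨hA, hA'⟩ ⟨hC, hC'⟩
    exact ⟨hA.add hC, by rw [add_mulVec, hA', hC', add_zero]⟩
  zero_mem' := ⟨isSymm_zero, zero_mulVec s⟩
  smul_mem' := by
    rintro a A ⟨hA, hA'⟩
    exact ⟨hA.smul a, by rw [smul_mulVec, hA', smul_zero]⟩

/-- The sense in which the prior parameter `V` is not unique for one observation `(s, y)`, but
unique globally. Here `c v` is the vector that `V v` has to match in direction `v`, and `A` is the
updated estimate after the observation `(s, y)`.
* The symmetric `W` with `W s = c s` form an affine subspace through `V`, which in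
dimension at least two has other definite members.
* All definite members, and their nonzero multiples, have the posterior mean `A`.
* `V` is the only matrix with `W v = c v` for every direction `v`. Up to a scalar factor it is also
the only one that does so up to a scalar factor in each direction. -/
def IsUniqueGlobalChoice (B₀ V : Matrix (Fin N) (Fin N) ℝ) (c : (Fin N → ℝ) → (Fin N → ℝ))
    (s y : Fin N → ℝ) (A : Matrix (Fin N) (Fin N) ℝ) : Prop :=
  choices s (c s) = (AffineSubspace.mk' V (annihilators s) : Set (Matrix (Fin N) (Fin N) ℝ)) ∧
  (2 ≤ N → ∃ W ∈ choices s (c s), IsDefinite W ∧ W ≠ V) ∧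
  (∀ W ∈ choices s (c s), IsDefinite W →
    ∀ a : ℝ, a ≠ 0 → IsOneStepPosteriorMean B₀ (a • W) s y A) ∧
  (∀ W : Matrix (Fin N) (Fin N) ℝ, (∀ v, W *ᵥ v = c v) ↔ W = V) ∧
  (∀ W : Matrix (Fin N) (Fin N) ℝ, (∀ v, ∃ a : ℝ, W *ᵥ v = a • c v) ↔ ∃ a : ℝ, W = a • V)

end SecantInference

end

open SecantInference

noncomputable section

namespace SecantInference

variable {N : ℕ}

/-! Let X follow the prior, put c = W s, and let T z be the Dennis correction with parameter c for
the target z (`dennisCLM`). T is the regression of X on X s: the residual X - T(X s) is uncorrelated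
with X s, hence independent of it by joint Gaussianity (`indepFun_applyCLM_residual`). So
conditioning on X s = z replaces X by residual + T z, and at z = y its mean is B₀ + T(y - B₀ s), the
Dennis update.

That this is the weak limit of the noisy posteriors is seen through the law of X s, which has a
positive continuous density g even though the prior on matrices may be singular
(`map_applyCLM_matrixPrior`). A Gaussian density is symmetric in mean and argument, so the
unnormalized posterior integral of f equals the integral of g(z) E[f(residual + T z)] against N(y,
Λ) (`integral_gaussianDensity_mul`). As Λ tends to 0 this tends to the value at z = y, and dividing
by the case f = 1 cancels g(y) (`isNoiseFreePosterior_conditionedPrior`).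

The Dennis update is homogeneous of degree 0 in c, so only the line through W s matters. This yields
all five rules and the freedom in W for a single s. Globally, V is invertible, and a matrix W V⁻¹
for which every nonzero vector is an eigenvector is scalar. -/

/-! ### Lebesgue densities of Gaussian measures. -/

/-- Both sides are finite measures with the same characteristic function, by the Fourier transform
of a Gaussian. -/
theorem stdGaussian_eq_withDensity (E : Type*) [NormedAddCommGroup E] [InnerProductSpace ℝ E]
    [FiniteDimensional ℝ E] [MeasurableSpace E] [BorelSpace E] :
    stdGaussian E = volume.withDensity (fun x : E => ENNReal.ofReal
      ((Real.sqrt ((2 * Real.pi) ^ Module.finrank ℝ E))⁻¹ * Real.exp (-(1 / 2) * ‖x‖ ^ 2))) := by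
  set n := Module.finrank ℝ E with hn
  set k := (Real.sqrt ((2 * Real.pi) ^ n))⁻¹ with hk
  have hkpos : 0 < k := by positivity
  have hint : Integrable (fun x : E => k * Real.exp (-(1 / 2) * ‖x‖ ^ 2)) := by
    refine Integrable.const_mul ?_ _
    have := (GaussianFourier.integrable_cexp_neg_mul_sq_norm_add (V := E)
      (b := (1 / 2 : ℂ)) (by norm_num) 0 0).norm
    refine this.congr (ae_of_all _ fun x => ?_)
    simp only [Complex.norm_exp]
    congr 1
    simp [← Complex.ofReal_pow]
  have : IsFiniteMeasure (volume.withDensity (fun x : E => ENNReal.ofReal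
      (k * Real.exp (-(1 / 2) * ‖x‖ ^ 2)))) :=
    isFiniteMeasure_withDensity_ofReal hint.2
  apply Measure.ext_of_charFun
  ext t
  rw [charFun_stdGaussian, charFun_apply, integral_withDensity_eq_integral_toReal_smul
    (by fun_prop) (ae_of_all _ fun _ => ENNReal.ofReal_lt_top)]
  have h1 : ∀ x : E, (ENNReal.ofReal (k * Real.exp (-(1 / 2) * ‖x‖ ^ 2))).toReal •
      Complex.exp (inner ℝ x t * Complex.I) =
      (k : ℂ) * Complex.exp (-(1 / 2 : ℂ) * ‖x‖ ^ 2 + Complex.I * inner ℝ t x) := by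
    intro x
    rw [ENNReal.toReal_ofReal (by positivity), Complex.real_smul, Complex.exp_add,
      real_inner_comm x t]
    push_cast
    ring_nf
  simp_rw [h1]
  rw [integral_const_mul, GaussianFourier.integral_cexp_neg_mul_sq_norm_add (by norm_num), ← mul_assoc]
  -- The Fourier integral contributes (2π)^(n/2), which the normalizing constant cancels.
  have h2 : (k : ℂ) * ((Real.pi : ℂ) / (1 / 2)) ^ ((Module.finrank ℝ E : ℂ) / 2) = 1 := by
    have : ((Real.pi : ℂ) / (1 / 2)) ^ ((Module.finrank ℝ E : ℂ) / 2) =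
        ((Real.sqrt ((2 * Real.pi) ^ n) : ℝ) : ℂ) := by
      rw [Real.sqrt_eq_rpow, ← Real.rpow_natCast, ← Real.rpow_mul (by positivity),
        Complex.ofReal_cpow (by positivity)]
      push_cast
      congr 1
      · ring
      · rw [← hn]; ring
    rw [this, ← Complex.ofReal_mul, hk, inv_mul_cancel₀ (by positivity), Complex.ofReal_one]
  rw [h2, one_mul, Complex.I_sq]
  congr 1
  ring

theorem continuous_gaussianDensity (m : Fin N → ℝ) (L : Matrix (Fin N) (Fin N) ℝ) :
    Continuous (gaussianDensity m L) := by
  unfold gaussianDensity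
  fun_prop

theorem gaussianDensity_nonneg (m : Fin N → ℝ) (L : Matrix (Fin N) (Fin N) ℝ) (x : Fin N → ℝ) :
    0 ≤ gaussianDensity m L x := by
  unfold gaussianDensity
  positivity

theorem gaussianDensity_pos (m : Fin N → ℝ) {L : Matrix (Fin N) (Fin N) ℝ} (hL : L.PosDef)
    (x : Fin N → ℝ) : 0 < gaussianDensity m L x := by
  have := hL.det_pos
  unfold gaussianDensity
  positivity

theorem gaussianDensity_le (m : Fin N → ℝ) {L : Matrix (Fin N) (Fin N) ℝ} (hL : L.PosDef)
    (x : Fin N → ℝ) :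
    gaussianDensity m L x ≤ (Real.sqrt ((2 * Real.pi) ^ N * L.det))⁻¹ := by
  unfold gaussianDensity
  refine mul_le_of_le_one_right (by positivity) (Real.exp_le_one_iff.2 ?_)
  have := hL.inv.posSemidef.dotProduct_mulVec_nonneg (x - m)
  simp only [star_trivial] at this
  linarith

theorem gaussianDensity_comm (m : Fin N → ℝ) (L : Matrix (Fin N) (Fin N) ℝ) (x : Fin N → ℝ) :
    gaussianDensity m L x = gaussianDensity x L m := by
  unfold gaussianDensity
  rw [← neg_sub m x, mulVec_neg, neg_dotProduct_neg]

-- Change of variables z = m + R x with R the square root of L; its Jacobian is det R.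
open scoped MatrixOrder in
theorem multivariateGaussian_eq_withDensity (m : EuclideanSpace ℝ (Fin N))
    {L : Matrix (Fin N) (Fin N) ℝ} (hL : L.PosDef) :
    multivariateGaussian m L =
      volume.withDensity (fun x => ENNReal.ofReal (gaussianDensity m.ofLp L x.ofLp)) := by
  set R := CFC.sqrt L with hR
  have hRR : R * R = L := CFC.sqrt_mul_sqrt_self L hL.posSemidef.nonneg
  have hRp : R.PosSemidef := Matrix.nonneg_iff_posSemidef.1 (CFC.sqrt_nonneg L)
  have hdet : R.det * R.det = L.det := by rw [← det_mul, hRR]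
  have hdet0 : R.det ≠ 0 := fun h => by
    have := hL.det_pos
    rw [← hdet, h] at this
    simp at this
  have hdetpos : 0 < R.det := lt_of_le_of_ne hRp.det_nonneg hdet0.symm
  set A : EuclideanSpace ℝ (Fin N) →L[ℝ] EuclideanSpace ℝ (Fin N) :=
    toEuclideanCLM (𝕜 := ℝ) R with hA
  have hdetA : LinearMap.det (A : EuclideanSpace ℝ (Fin N) →ₗ[ℝ] EuclideanSpace ℝ (Fin N)) = R.det := by
    rw [hA, coe_toEuclideanCLM_eq_toEuclideanLin, toEuclideanLin_eq_toLin_orthonormal,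
      LinearMap.det_toLin]
  have hchange : ∀ h : EuclideanSpace ℝ (Fin N) → ENNReal, Measurable h →
      ∫⁻ x, h (m + A x) = ENNReal.ofReal R.det⁻¹ * ∫⁻ z, h z := by
    intro h hh
    have h1 : Measure.map A (volume : Measure (EuclideanSpace ℝ (Fin N))) =
        ENNReal.ofReal R.det⁻¹ • volume := by
      have := Measure.map_linearMap_addHaar_eq_smul_addHaar
        (volume : Measure (EuclideanSpace ℝ (Fin N)))
        (f := (A : EuclideanSpace ℝ (Fin N) →ₗ[ℝ] EuclideanSpace ℝ (Fin N)))
        (by rw [hdetA]; exact hdet0)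
      rw [hdetA, abs_of_pos (inv_pos.2 hdetpos)] at this
      exact this
    calc ∫⁻ x, h (m + A x) = ∫⁻ z, h (m + z) ∂(Measure.map A volume) :=
          (lintegral_map (hh.comp (measurable_const_add m)) A.continuous.measurable).symm
      _ = ENNReal.ofReal R.det⁻¹ * ∫⁻ z, h z := by
          rw [h1, lintegral_smul_measure, lintegral_add_left_eq_self, smul_eq_mul]
  ext U hU
  have hgm : Measurable fun x : EuclideanSpace ℝ (Fin N) =>
      ENNReal.ofReal (gaussianDensity m.ofLp L x.ofLp) :=
    ((continuous_gaussianDensity _ _).comp (PiLp.continuous_ofLp 2 _)).measurable.ennreal_ofReal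
  rw [multivariateGaussian, Measure.map_apply (by fun_prop) hU, stdGaussian_eq_withDensity,
    withDensity_apply _ (by measurability), withDensity_apply _ hU,
    ← lintegral_indicator (by measurability), ← lintegral_indicator hU]
  have hfac : ∀ x : EuclideanSpace ℝ (Fin N),
      (Real.sqrt ((2 * Real.pi) ^ Module.finrank ℝ (EuclideanSpace ℝ (Fin N))))⁻¹ *
        Real.exp (-(1 / 2) * ‖x‖ ^ 2) =
      R.det * gaussianDensity m.ofLp L (m + A x).ofLp := by
    intro x
    have h2 : (m + A x).ofLp - m.ofLp = R *ᵥ x.ofLp := by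
      rw [hA, WithLp.ofLp_add, ofLp_toEuclideanCLM, add_sub_cancel_left]
    have h3 : (R *ᵥ x.ofLp) ⬝ᵥ (L⁻¹ *ᵥ (R *ᵥ x.ofLp)) = ‖x‖ ^ 2 := by
      have hRu : IsUnit R.det := isUnit_iff_ne_zero.2 hdet0
      have hRT : Rᵀ = R := by simpa [conjTranspose_eq_transpose_of_trivial] using hRp.isHermitian.eq
      rw [← hRR, Matrix.mul_inv_rev, mulVec_mulVec, Matrix.mul_assoc, nonsing_inv_mul _ hRu, mul_one]
      rw [dotProduct_mulVec, ← mulVec_transpose, transpose_nonsing_inv, hRT, mulVec_mulVec,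
        nonsing_inv_mul _ hRu, one_mulVec, EuclideanSpace.real_norm_sq_eq]
      simp [dotProduct, sq]
    unfold gaussianDensity
    rw [h2, h3, finrank_euclideanSpace_fin, ← hdet, Real.sqrt_mul (by positivity),
      Real.sqrt_mul_self hdetpos.le, mul_inv]
    field_simp
  -- The factor det R in the test function absorbs the Jacobian.
  have key := hchange (fun z => ENNReal.ofReal R.det *
    U.indicator (fun x => ENNReal.ofReal (gaussianDensity m.ofLp L x.ofLp)) z)
    ((hgm.indicator hU).const_mul _)
  rw [lintegral_const_mul _ (hgm.indicator hU), ← mul_assoc,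
    ← ENNReal.ofReal_mul (inv_pos.2 hdetpos).le, inv_mul_cancel₀ hdet0, ENNReal.ofReal_one,
    one_mul] at key
  rw [← key]
  refine lintegral_congr fun x => ?_
  by_cases hx : m + A x ∈ U
  · rw [Set.indicator_of_mem (show x ∈ _ from hx), Set.indicator_of_mem hx, hfac,
      ENNReal.ofReal_mul hdetpos.le]
  · rw [Set.indicator_of_notMem (show x ∉ _ from hx), Set.indicator_of_notMem hx, mul_zero]

/-! ### Concentration of Gaussians as the covariance vanishes. -/

-- The diagonal entry of L is the squared norm of a column of its square root. This gives continuity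
-- of the square root at 0 along positive definite matrices.
open scoped MatrixOrder in
theorem sq_sqrt_apply_le {L : Matrix (Fin N) (Fin N) ℝ} (hL : L.PosSemidef) (i j : Fin N) :
    (CFC.sqrt L i j) ^ 2 ≤ L j j := by
  have hRR : CFC.sqrt L * CFC.sqrt L = L := CFC.sqrt_mul_sqrt_self L hL.nonneg
  have hRp : (CFC.sqrt L).PosSemidef := Matrix.nonneg_iff_posSemidef.1 (CFC.sqrt_nonneg L)
  have hsym : ∀ a b, CFC.sqrt L a b = CFC.sqrt L b a := fun a b => by
    simpa using hRp.isHermitian.apply b a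
  calc (CFC.sqrt L i j) ^ 2 ≤ ∑ k, (CFC.sqrt L k j) ^ 2 :=
        Finset.single_le_sum (f := fun k => (CFC.sqrt L k j) ^ 2)
          (fun _ _ => sq_nonneg _) (Finset.mem_univ i)
    _ = (CFC.sqrt L * CFC.sqrt L) j j := by
        rw [Matrix.mul_apply]
        exact Finset.sum_congr rfl fun k _ => by rw [sq, hsym j k]
    _ = L j j := by rw [hRR]

open scoped MatrixOrder in
theorem tendsto_sqrt_nhdsWithin_zero :
    Tendsto (fun L : Matrix (Fin N) (Fin N) ℝ => CFC.sqrt L) (𝓝[{L | L.PosDef}] 0) (𝓝 0) := by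
  refine tendsto_pi_nhds.2 fun i => tendsto_pi_nhds.2 fun j => ?_
  have h1 : Tendsto (fun L : Matrix (Fin N) (Fin N) ℝ => Real.sqrt (L j j))
      (𝓝[{L | L.PosDef}] 0) (𝓝 0) := by
    have : Continuous fun L : Matrix (Fin N) (Fin N) ℝ => Real.sqrt (L j j) := by fun_prop
    simpa using (this.tendsto 0).mono_left nhdsWithin_le_nhds
  refine squeeze_zero_norm' ?_ h1
  filter_upwards [self_mem_nhdsWithin] with L hL
  exact Real.abs_le_sqrt (sq_sqrt_apply_le (Matrix.PosDef.posSemidef hL) i j)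

open scoped MatrixOrder in
/-- A Gaussian concentrates at its mean as the covariance tends to zero. -/
theorem tendsto_integral_multivariateGaussian (y : EuclideanSpace ℝ (Fin N))
    {h : EuclideanSpace ℝ (Fin N) → ℝ} (hc : Continuous h) {K : ℝ} (hK : ∀ x, |h x| ≤ K) :
    Tendsto (fun L : Matrix (Fin N) (Fin N) ℝ => ∫ z, h z ∂(multivariateGaussian y L))
      (𝓝[{L | L.PosDef}] 0) (𝓝 (h y)) := by
  have h1 : ∀ L : Matrix (Fin N) (Fin N) ℝ, ∫ z, h z ∂(multivariateGaussian y L) =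
      ∫ x, h (y + toEuclideanCLM (𝕜 := ℝ) (CFC.sqrt L) x)
        ∂(stdGaussian (EuclideanSpace ℝ (Fin N))) := fun L => by
    rw [multivariateGaussian, integral_map (by fun_prop) hc.aestronglyMeasurable]
  -- All integrals are now over one fixed standard Gaussian, so dominated convergence applies; it
  -- needs a countably generated filter.
  simp_rw [h1]
  have : (𝓝[{L : Matrix (Fin N) (Fin N) ℝ | L.PosDef}] 0).IsCountablyGenerated := by
    have : FirstCountableTopology (Matrix (Fin N) (Fin N) ℝ) :=
      inferInstanceAs (FirstCountableTopology (Fin N → Fin N → ℝ))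
    infer_instance
  have h2 : h y = ∫ _, h y ∂(stdGaussian (EuclideanSpace ℝ (Fin N))) := by simp
  rw [h2]
  refine tendsto_integral_filter_of_dominated_convergence (fun _ => K) ?_ ?_
    (integrable_const _) ?_
  · exact Eventually.of_forall fun L => (by fun_prop : Continuous fun x =>
      h (y + toEuclideanCLM (𝕜 := ℝ) (CFC.sqrt L) x)).aestronglyMeasurable
  · exact Eventually.of_forall fun L => ae_of_all _ fun x => hK _
  · refine ae_of_all _ fun x => (hc.tendsto y).comp ?_
    have hcont : Continuous fun M : Matrix (Fin N) (Fin N) ℝ =>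
        y + toEuclideanCLM (𝕜 := ℝ) M x := by
      have : (fun M : Matrix (Fin N) (Fin N) ℝ => y + toEuclideanCLM (𝕜 := ℝ) M x) =
          fun M => y + WithLp.toLp 2 (M *ᵥ x.ofLp) := rfl
      rw [this]
      fun_prop
    simpa [Function.comp_def] using (hcont.tendsto 0).comp tendsto_sqrt_nhdsWithin_zero

/-! ### Definite matrices and the prior covariance. -/

theorem symKron_neg (W : Matrix (Fin N) (Fin N) ℝ) : symKron (-W) = symKron W := by
  ext p q
  simp [symKron]

open Kronecker in
theorem posSemidef_symKron_of_posSemidef {W : Matrix (Fin N) (Fin N) ℝ} (hW : W.PosSemidef) :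
    (symKron W).PosSemidef := by
  -- P is the projection G ↦ (G + Gᵀ)/2 onto symmetric matrices, and `symKron W` is W ⊗ W compressed
  -- by it.
  set P : Matrix (Fin N × Fin N) (Fin N × Fin N) ℝ :=
    (1 / 2 : ℝ) • (1 + (1 : Matrix (Fin N × Fin N) (Fin N × Fin N) ℝ).submatrix id Prod.swap)
  have h := (hW.kronecker hW).conjTranspose_mul_mul_same P
  suffices key : symKron W = Pᴴ * kroneckerMap (fun x y => x * y) W W * P by
    rw [key]
    exact h
  have hsub : ∀ M : Matrix (Fin N × Fin N) (Fin N × Fin N) ℝ,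
      M * (1 : Matrix (Fin N × Fin N) (Fin N × Fin N) ℝ).submatrix id Prod.swap =
        M.submatrix id Prod.swap := fun M => by
    ext p q
    simp [Matrix.mul_apply, Matrix.one_apply]
  have hsub' : ∀ M : Matrix (Fin N × Fin N) (Fin N × Fin N) ℝ,
      (1 : Matrix (Fin N × Fin N) (Fin N × Fin N) ℝ).submatrix Prod.swap id * M =
        M.submatrix Prod.swap id := fun M => by
    ext p q
    simp [Matrix.mul_apply, Matrix.one_apply]
  have hP : Pᴴ = (1 / 2 : ℝ) •
      (1 + (1 : Matrix (Fin N × Fin N) (Fin N × Fin N) ℝ).submatrix Prod.swap id) := by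
    simp [P]
  rw [hP]
  simp only [P, Matrix.smul_mul, Matrix.mul_smul, Matrix.mul_add, Matrix.add_mul, hsub, hsub',
    Matrix.one_mul, Matrix.mul_one]
  ext p q
  simp [symKron, kroneckerMap_apply]
  ring

theorem IsDefinite.posSemidef_symKron {W : Matrix (Fin N) (Fin N) ℝ} (hW : IsDefinite W) :
    (symKron W).PosSemidef := by
  rcases hW with h | h
  · exact posSemidef_symKron_of_posSemidef h.posSemidef
  · rw [← symKron_neg]
    exact posSemidef_symKron_of_posSemidef h.posSemidef

theorem IsDefinite.isSymm {W : Matrix (Fin N) (Fin N) ℝ} (hW : IsDefinite W) : W.IsSymm := by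
  rcases hW with h | h
  · exact (conjTranspose_eq_transpose_of_trivial W).symm.trans h.isHermitian.eq
  · have := h.isHermitian.eq
    rw [conjTranspose_neg, neg_inj, conjTranspose_eq_transpose_of_trivial] at this
    exact this

theorem IsDefinite.smul {W : Matrix (Fin N) (Fin N) ℝ} (hW : IsDefinite W) {a : ℝ} (ha : a ≠ 0) :
    IsDefinite (a • W) := by
  rcases lt_or_gt_of_ne ha with h | h <;> rcases hW with hW | hW
  · refine Or.inr ?_
    rw [← neg_smul]
    exact hW.smul (neg_pos.2 h)
  · refine Or.inl ?_
    rw [← neg_smul_neg]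
    exact hW.smul (neg_pos.2 h)
  · exact Or.inl (hW.smul h)
  · refine Or.inr ?_
    rw [← smul_neg]
    exact hW.smul h

/-- The scalar sᵀ W s carries the sign of W, so the product is positive definite for either sign. -/
theorem IsDefinite.posDef_quadratic_smul {W : Matrix (Fin N) (Fin N) ℝ} (hW : IsDefinite W)
    {s : Fin N → ℝ} (hs : s ≠ 0) : ((W *ᵥ s ⬝ᵥ s) • W).PosDef := by
  rcases hW with h | h
  · have := h.dotProduct_mulVec_pos hs
    rw [star_trivial, dotProduct_comm] at this
    exact h.smul this
  · have := h.dotProduct_mulVec_pos hs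
    rw [star_trivial, dotProduct_comm, neg_mulVec, neg_dotProduct] at this
    rw [← neg_smul_neg]
    exact h.smul this

theorem IsDefinite.mulVec_dotProduct_ne_zero {W : Matrix (Fin N) (Fin N) ℝ} (hW : IsDefinite W)
    {s : Fin N → ℝ} (hs : s ≠ 0) : W *ᵥ s ⬝ᵥ s ≠ 0 := by
  intro h
  have := (hW.posDef_quadratic_smul hs).dotProduct_mulVec_pos hs
  simp [h] at this

/-! ### The observation map, the Dennis correction, and their adjoints. -/

/-- The linear map sending a (vectorized) matrix to its product with `s`. -/
def applyCLM (s : Fin N → ℝ) : VecMat N →L[ℝ] EuclideanSpace ℝ (Fin N) :=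
  LinearMap.toContinuousLinearMap
    { toFun := fun v => WithLp.toLp 2 (unvect v *ᵥ s)
      map_add' := fun u v => by
        change WithLp.toLp 2 ((unvect u + unvect v) *ᵥ s) = _
        rw [add_mulVec]
        rfl
      map_smul' := fun a v => by
        change WithLp.toLp 2 ((a • unvect v) *ᵥ s) = _
        rw [smul_mulVec]
        rfl }

theorem ofLp_applyCLM (s : Fin N → ℝ) (v : VecMat N) :
    (applyCLM s v).ofLp = unvect v *ᵥ s := rfl

/-- The symmetric correction of the Dennis class with parameter `c` that maps `s` to a given
vector. -/
def dennisCLM (s c : Fin N → ℝ) : EuclideanSpace ℝ (Fin N) →L[ℝ] VecMat N :=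
  LinearMap.toContinuousLinearMap
    { toFun := fun z => vect ((c ⬝ᵥ s)⁻¹ • (vecMulVec z.ofLp c + vecMulVec c z.ofLp) -
        ((s ⬝ᵥ z.ofLp) / (c ⬝ᵥ s) ^ 2) • vecMulVec c c)
      map_add' := fun u v => by
        ext p
        simp [vect, vecMulVec_apply, dotProduct_add]
        ring
      map_smul' := fun a v => by
        ext p
        simp [vect, vecMulVec_apply, dotProduct_smul]
        ring }

theorem dennisCLM_apply (s c : Fin N → ℝ) (z : EuclideanSpace ℝ (Fin N)) :
    dennisCLM s c z = vect ((c ⬝ᵥ s)⁻¹ • (vecMulVec z.ofLp c + vecMulVec c z.ofLp) -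
        ((s ⬝ᵥ z.ofLp) / (c ⬝ᵥ s) ^ 2) • vecMulVec c c) := rfl

theorem vect_dennisUpdate (B₀ : Matrix (Fin N) (Fin N) ℝ) (s y c : Fin N → ℝ) :
    vect (dennisUpdate B₀ s y c) =
      vect B₀ + dennisCLM s c (WithLp.toLp 2 y - applyCLM s (vect B₀)) := by
  rw [dennisCLM_apply]
  ext p
  simp only [vect, dennisUpdate, PiLp.add_apply, Matrix.sub_apply, Matrix.add_apply]
  rw [add_sub_assoc]
  rfl

theorem inner_applyCLM (s : Fin N → ℝ) (a : EuclideanSpace ℝ (Fin N)) (v : VecMat N) :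
    inner ℝ a (applyCLM s v) = inner ℝ (vect (vecMulVec a.ofLp s)) v := by
  simp only [PiLp.inner_apply, ofLp_applyCLM, Fintype.sum_prod_type]
  refine Finset.sum_congr rfl fun i _ => ?_
  simp only [mulVec, dotProduct, RCLike.inner_apply, conj_trivial, Finset.sum_mul, vect,
    vecMulVec_apply]
  exact Finset.sum_congr rfl fun j _ => by simp [unvect]; ring

theorem adjoint_applyCLM (s : Fin N → ℝ) (a : EuclideanSpace ℝ (Fin N)) :
    (applyCLM s).adjoint a = vect (vecMulVec a.ofLp s) :=
  ext_inner_right ℝ fun v => by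
    rw [ContinuousLinearMap.adjoint_inner_left, inner_applyCLM]

theorem adjoint_dennisCLM (s c : Fin N → ℝ) (G : Matrix (Fin N) (Fin N) ℝ) :
    (dennisCLM s c).adjoint (vect G) = WithLp.toLp 2 ((c ⬝ᵥ s)⁻¹ • ((G + Gᵀ) *ᵥ c) -
      ((c ⬝ᵥ ((G + Gᵀ) *ᵥ c)) / (2 * (c ⬝ᵥ s) ^ 2)) • s) := by
  refine ext_inner_right ℝ fun z => ?_
  rw [ContinuousLinearMap.adjoint_inner_left, dennisCLM_apply]
  have h1 : ∀ a b : Fin N → ℝ, inner ℝ (vect G) (vect (vecMulVec a b)) = a ⬝ᵥ (G *ᵥ b) := by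
    intro a b
    simp only [PiLp.inner_apply, Fintype.sum_prod_type, vect, RCLike.inner_apply, conj_trivial,
      vecMulVec_apply, dotProduct, mulVec, Finset.mul_sum]
    exact Finset.sum_congr rfl fun i _ => Finset.sum_congr rfl fun j _ => by ring
  have h3 : ∀ a b : Fin N → ℝ, a ⬝ᵥ (G *ᵥ b) = b ⬝ᵥ (Gᵀ *ᵥ a) := by
    intro a b
    rw [dotProduct_mulVec, ← mulVec_transpose, dotProduct_comm]
  have h4 : ∀ a : Fin N → ℝ, inner ℝ (WithLp.toLp 2 a : EuclideanSpace ℝ (Fin N)) z =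
      a ⬝ᵥ z.ofLp := by
    intro a
    simp [PiLp.inner_apply, dotProduct, mul_comm]
  have h5 : ∀ (k l : ℝ) (X Y Z : Matrix (Fin N) (Fin N) ℝ),
      vect (k • (X + Y) - l • Z) = k • (vect X + vect Y) - l • vect Z := fun _ _ _ _ _ => rfl
  rw [h5, inner_sub_right, inner_smul_right, inner_smul_right, inner_add_right, h1, h1, h1, h4,
    sub_dotProduct, smul_dotProduct, smul_dotProduct, dotProduct_comm ((G + Gᵀ) *ᵥ c) z.ofLp, add_mulVec,
    dotProduct_add, dotProduct_add, h3 c z.ofLp, ← h3 c c]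
  simp only [smul_eq_mul]
  field_simp
  ring

/-- For symmetric W the covariance acts on matrices as G ↦ W (G + Gᵀ) W / 2. Paired with a sᵀ, it
sees G only through (G + Gᵀ) W s. -/
theorem dotProduct_symKron_mulVec {W : Matrix (Fin N) (Fin N) ℝ} (hW : W.IsSymm)
    (a s : Fin N → ℝ) (G : Matrix (Fin N) (Fin N) ℝ) :
    (vect (vecMulVec a s)).ofLp ⬝ᵥ (symKron W *ᵥ (vect G).ofLp) =
      (a ⬝ᵥ (W *ᵥ ((G + Gᵀ) *ᵥ (W *ᵥ s)))) / 2 := by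
  have hs : ∀ i j, W i j = W j i := fun i j => hW.apply j i
  have h1 : ∀ p : Fin N × Fin N, (symKron W *ᵥ (vect G).ofLp) p =
      ((W * G * W) p.1 p.2 + (W * Gᵀ * W) p.1 p.2) / 2 := by
    intro p
    have e1 : (W * G * W) p.1 p.2 = ∑ k, ∑ l, W p.1 k * W p.2 l * G k l := by
      rw [Matrix.mul_assoc, Matrix.mul_apply]
      simp only [Matrix.mul_apply, Finset.mul_sum]
      exact Finset.sum_congr rfl fun k _ => Finset.sum_congr rfl fun l _ => by
        rw [hs l p.2]; ring
    have e2 : (W * Gᵀ * W) p.1 p.2 = ∑ k, ∑ l, W p.2 k * W p.1 l * G k l := by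
      rw [Matrix.mul_apply]
      simp only [Matrix.mul_apply, Finset.sum_mul, transpose_apply]
      exact Finset.sum_congr rfl fun k _ => Finset.sum_congr rfl fun l _ => by
        rw [hs k p.2]; ring
    rw [e1, e2]
    simp only [mulVec, dotProduct, symKron, vect, Matrix.of_apply, Fintype.sum_prod_type,
      ← Finset.sum_add_distrib, Finset.sum_div]
    exact Finset.sum_congr rfl fun k _ => Finset.sum_congr rfl fun l _ => by ring
  have h2 : W *ᵥ ((G + Gᵀ) *ᵥ (W *ᵥ s)) = (W * G * W + W * Gᵀ * W) *ᵥ s := by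
    rw [mulVec_mulVec, mulVec_mulVec, Matrix.mul_add, Matrix.add_mul]
  rw [h2]
  rw [dotProduct]
  simp_rw [h1]
  simp only [dotProduct, Fintype.sum_prod_type, mulVec, Matrix.add_apply, vect, vecMulVec_apply,
    Finset.mul_sum, Finset.sum_div]
  exact Finset.sum_congr rfl fun i _ => Finset.sum_congr rfl fun j _ => by ring

instance (B₀ W : Matrix (Fin N) (Fin N) ℝ) : IsGaussian (matrixPrior B₀ W) :=
  isGaussian_multivariateGaussian

theorem covarianceBilin_matrixPrior (B₀ : Matrix (Fin N) (Fin N) ℝ)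
    {W : Matrix (Fin N) (Fin N) ℝ} (hW : IsDefinite W) (a s : Fin N → ℝ)
    (G : Matrix (Fin N) (Fin N) ℝ) :
    covarianceBilin (matrixPrior B₀ W) (vect (vecMulVec a s)) (vect G) =
      (a ⬝ᵥ (W *ᵥ ((G + Gᵀ) *ᵥ (W *ᵥ s)))) / 2 := by
  rw [matrixPrior, covarianceBilin_multivariateGaussian hW.posSemidef_symKron,
    dotProduct_symKron_mulVec hW.isSymm]

/-! ### The law of X s and the independent residual. -/

/-- The covariance matrix of `X s` when the covariance of `X` is `symKron W`. -/
def observationCov (W : Matrix (Fin N) (Fin N) ℝ) (s : Fin N → ℝ) : Matrix (Fin N) (Fin N) ℝ :=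
  (1 / 2 : ℝ) • ((W *ᵥ s ⬝ᵥ s) • W + vecMulVec (W *ᵥ s) (W *ᵥ s))

theorem posDef_observationCov {W : Matrix (Fin N) (Fin N) ℝ} (hW : IsDefinite W)
    {s : Fin N → ℝ} (hs : s ≠ 0) : (observationCov W s).PosDef := by
  refine PosDef.smul ((hW.posDef_quadratic_smul hs).add_posSemidef ?_) (by norm_num)
  simpa using posSemidef_vecMulVec_self_star (W *ᵥ s)

/-- Both measures are Gaussian, so comparing means and covariances suffices. -/
theorem map_applyCLM_matrixPrior (B₀ : Matrix (Fin N) (Fin N) ℝ)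
    {W : Matrix (Fin N) (Fin N) ℝ} (hW : IsDefinite W) {s : Fin N → ℝ} (hs : s ≠ 0) :
    (matrixPrior B₀ W).map (applyCLM s) =
      multivariateGaussian (applyCLM s (vect B₀)) (observationCov W s) := by
  apply IsGaussian.ext
  · simp only [id_eq, integral_id_multivariateGaussian]
    rw [(applyCLM s).integral_id_map IsGaussian.integrable_id, matrixPrior,
      integral_id_multivariateGaussian]
  · ext a b
    rw [covarianceBilin_map IsGaussian.memLp_two_id, adjoint_applyCLM, adjoint_applyCLM,
      covarianceBilin_matrixPrior B₀ hW,
      covarianceBilin_multivariateGaussian (posDef_observationCov hW hs).posSemidef, observationCov]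
    have h1 : a.ofLp ⬝ᵥ (W *ᵥ s) = (W *ᵥ s) ⬝ᵥ a.ofLp := dotProduct_comm _ _
    simp only [transpose_vecMulVec, add_mulVec, vecMulVec_mulVec, mulVec_add, smul_mulVec,
      dotProduct_add, dotProduct_smul, op_smul_eq_smul, mulVec_smul, smul_eq_mul,
      dotProduct_comm s (W *ᵥ s), dotProduct_comm b.ofLp (W *ᵥ s), h1]
    ring

theorem indepFun_applyCLM_residual (B₀ : Matrix (Fin N) (Fin N) ℝ)
    {W : Matrix (Fin N) (Fin N) ℝ} (hW : IsDefinite W) {s : Fin N → ℝ} (hs : s ≠ 0) :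
    IndepFun (fun v => applyCLM s v) (fun v => v - dennisCLM s (W *ᵥ s) (applyCLM s v))
      (matrixPrior B₀ W) := by
  set c := W *ᵥ s with hc
  have hcs : c ⬝ᵥ s ≠ 0 := hW.mulVec_dotProduct_ne_zero hs
  apply HasGaussianLaw.indepFun_of_covariance_inner
  · exact (IsGaussian.hasGaussianLaw_id (μ := matrixPrior B₀ W)).map_fun
      ((applyCLM s).prod (ContinuousLinearMap.id ℝ _ - (dennisCLM s c).comp (applyCLM s)))
  · intro a b
    set G := unvect b with hG
    have hb : b = vect G := rfl
    -- This is the adjoint of `dennisCLM s c` at G, so pairing the residual with G is pairing X with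
    -- G - h sᵀ.
    set h : Fin N → ℝ := (c ⬝ᵥ s)⁻¹ • ((G + Gᵀ) *ᵥ c) -
      ((c ⬝ᵥ ((G + Gᵀ) *ᵥ c)) / (2 * (c ⬝ᵥ s) ^ 2)) • s with hh
    have h1 : ∀ v, inner ℝ b (v - dennisCLM s c (applyCLM s v)) =
        inner ℝ (vect (G - vecMulVec h s)) v := by
      intro v
      have : vect (G - vecMulVec h s) = b - vect (vecMulVec h s) := rfl
      rw [this, inner_sub_right, inner_sub_left, ← ContinuousLinearMap.adjoint_inner_left, hb,
        adjoint_dennisCLM, inner_applyCLM]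
    simp_rw [h1, inner_applyCLM]
    rw [← covarianceBilin_apply_eq_cov IsGaussian.memLp_two_id, covarianceBilin_matrixPrior B₀ hW]
    -- Here the choice c = W s enters: the covariance with X s depends only on this symmetrized
    -- matrix applied to W s.
    have h2 : (G - vecMulVec h s + (G - vecMulVec h s)ᵀ) *ᵥ c = 0 := by
      have : G - vecMulVec h s + (G - vecMulVec h s)ᵀ =
          (G + Gᵀ) - (vecMulVec h s + vecMulVec s h) := by
        rw [transpose_sub, transpose_vecMulVec]
        abel
      rw [this, sub_mulVec]
      set g := (G + Gᵀ) *ᵥ c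
      rw [add_mulVec, vecMulVec_mulVec, vecMulVec_mulVec, hh, sub_dotProduct, smul_dotProduct,
        smul_dotProduct, dotProduct_comm s c, dotProduct_comm g c]
      ext i
      simp only [Pi.sub_apply, Pi.smul_apply, Pi.add_apply, Pi.zero_apply, op_smul_eq_smul,
        smul_eq_mul]
      field_simp
      ring
    rw [← hc, h2]
    simp

/-! ### The conditioned prior and its mean. -/

/-- Condition a matrix on its product with `s` being `z`, by correcting it within the Dennis
class. -/
def conditionTo (s c : Fin N → ℝ) (z : EuclideanSpace ℝ (Fin N)) (v : VecMat N) : VecMat N :=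
  v - dennisCLM s c (applyCLM s v) + dennisCLM s c z

theorem continuous_conditionTo (s c : Fin N → ℝ) (z : EuclideanSpace ℝ (Fin N)) :
    Continuous (conditionTo s c z) := by
  unfold conditionTo
  fun_prop

theorem continuous_conditionTo_left (s c : Fin N → ℝ) (v : VecMat N) :
    Continuous (fun z => conditionTo s c z v) := by
  unfold conditionTo
  fun_prop

/-- The noise-free posterior: the law of the prior conditioned on the product with `s` being `y`. -/
def conditionedPrior (B₀ W : Matrix (Fin N) (Fin N) ℝ) (s y : Fin N → ℝ) : Measure (VecMat N) :=
  (matrixPrior B₀ W).map (conditionTo s (W *ᵥ s) (WithLp.toLp 2 y))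

instance (B₀ W : Matrix (Fin N) (Fin N) ℝ) (s y : Fin N → ℝ) :
    IsProbabilityMeasure (conditionedPrior B₀ W s y) :=
  Measure.isProbabilityMeasure_map (continuous_conditionTo _ _ _).aemeasurable

theorem integrable_conditionTo (B₀ W : Matrix (Fin N) (Fin N) ℝ) (s c : Fin N → ℝ)
    (z : EuclideanSpace ℝ (Fin N)) : Integrable (conditionTo s c z) (matrixPrior B₀ W) := by
  have hid : Integrable (fun v => v) (matrixPrior B₀ W) := IsGaussian.integrable_fun_id
  exact (hid.sub (((dennisCLM s c).comp (applyCLM s)).integrable_comp hid)).add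
    (integrable_const _)

theorem integral_id_conditionedPrior (B₀ W : Matrix (Fin N) (Fin N) ℝ) (s y : Fin N → ℝ) :
    ∫ v, v ∂(conditionedPrior B₀ W s y) = vect (dennisUpdate B₀ s y (W *ᵥ s)) := by
  have hid : Integrable (fun v => v) (matrixPrior B₀ W) := IsGaussian.integrable_fun_id
  have hTS : Integrable (fun v => dennisCLM s (W *ᵥ s) (applyCLM s v)) (matrixPrior B₀ W) :=
    ((dennisCLM s (W *ᵥ s)).comp (applyCLM s)).integrable_comp hid
  have hres : Integrable (fun v => v - dennisCLM s (W *ᵥ s) (applyCLM s v)) (matrixPrior B₀ W) :=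
    hid.sub hTS
  have hmean : ∫ v, v ∂(matrixPrior B₀ W) = vect B₀ := integral_id_multivariateGaussian
  have hmeanTS : ∫ v, dennisCLM s (W *ᵥ s) (applyCLM s v) ∂(matrixPrior B₀ W) =
      dennisCLM s (W *ᵥ s) (applyCLM s (vect B₀)) := by
    rw [← hmean]
    exact ((dennisCLM s (W *ᵥ s)).comp (applyCLM s)).integral_comp_comm hid
  rw [conditionedPrior, integral_map (f := fun v : VecMat N => v)
    (continuous_conditionTo _ _ _).aemeasurable aestronglyMeasurable_id]
  simp only [conditionTo]
  rw [integral_add hres (integrable_const _), integral_sub hid hTS, hmeanTS, hmean,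
    integral_const, probReal_univ, one_smul, vect_dennisUpdate, map_sub]
  abel

/-! ### Noisy posteriors and their noise-free limit. -/

/-- The conditional expectation of `f` given that the product with `s` is `z`. -/
def conditionalMean (B₀ W : Matrix (Fin N) (Fin N) ℝ) (s : Fin N → ℝ) (f : VecMat N → ℝ)
    (z : EuclideanSpace ℝ (Fin N)) : ℝ :=
  ∫ v, f (conditionTo s (W *ᵥ s) z v) ∂(matrixPrior B₀ W)

theorem continuous_conditionalMean (B₀ W : Matrix (Fin N) (Fin N) ℝ) (s : Fin N → ℝ)
    (f : BoundedContinuousFunction (VecMat N) ℝ) :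
    Continuous (conditionalMean B₀ W s f) := by
  refine continuous_of_dominated (bound := fun _ => ‖f‖) (fun z => ?_) (fun z => ?_)
    (integrable_const _) ?_
  · exact (f.continuous.comp (continuous_conditionTo _ _ _)).aestronglyMeasurable
  · exact ae_of_all _ fun v => f.norm_coe_le_norm _
  · exact ae_of_all _ fun v => f.continuous.comp (continuous_conditionTo_left _ _ _)

theorem abs_conditionalMean_le (B₀ W : Matrix (Fin N) (Fin N) ℝ) (s : Fin N → ℝ)
    (f : BoundedContinuousFunction (VecMat N) ℝ) (z : EuclideanSpace ℝ (Fin N)) :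
    |conditionalMean B₀ W s f z| ≤ ‖f‖ := by
  have := norm_integral_le_of_norm_le_const (μ := matrixPrior B₀ W) (C := ‖f‖)
    (f := fun v => f (conditionTo s (W *ᵥ s) z v)) (ae_of_all _ fun v => f.norm_coe_le_norm _)
  simpa [conditionalMean] using this

/-- By independence, the joint law of X s and the residual is a product measure, and Fubini
integrates out the residual. -/
theorem integral_matrixPrior_eq (B₀ : Matrix (Fin N) (Fin N) ℝ) {W : Matrix (Fin N) (Fin N) ℝ}
    (hW : IsDefinite W) {s : Fin N → ℝ} (hs : s ≠ 0)
    {k : EuclideanSpace ℝ (Fin N) → ℝ} (hk : Continuous k) {K : ℝ} (hK : ∀ z, |k z| ≤ K)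
    (f : BoundedContinuousFunction (VecMat N) ℝ) :
    ∫ v, k (applyCLM s v) * f v ∂(matrixPrior B₀ W) =
      ∫ z, k z * conditionalMean B₀ W s f z ∂((matrixPrior B₀ W).map (applyCLM s)) := by
  set p := matrixPrior B₀ W
  set S := applyCLM (N := N) s
  set T := dennisCLM s (W *ᵥ s)
  have hcont : Continuous fun v => v - T (S v) := by fun_prop
  have hprod : p.map (fun v => (S v, v - T (S v))) =
      (p.map S).prod (p.map (fun v => v - T (S v))) :=
    (indepFun_iff_map_prod_eq_prod_map_map S.continuous.aemeasurable hcont.aemeasurable).1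
      (indepFun_applyCLM_residual B₀ hW hs)
  have hF : Continuous fun q : EuclideanSpace ℝ (Fin N) × VecMat N =>
      k q.1 * f (q.2 + T q.1) := by fun_prop
  have : IsProbabilityMeasure (p.map S) :=
    Measure.isProbabilityMeasure_map S.continuous.aemeasurable
  have : IsProbabilityMeasure (p.map (fun v => v - T (S v))) :=
    Measure.isProbabilityMeasure_map hcont.aemeasurable
  have hint : Integrable (fun q : EuclideanSpace ℝ (Fin N) × VecMat N =>
      k q.1 * f (q.2 + T q.1)) ((p.map S).prod (p.map (fun v => v - T (S v)))) := by
    refine Integrable.of_bound hF.aestronglyMeasurable (K * ‖f‖) (ae_of_all _ fun q => ?_)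
    rw [norm_mul]
    exact mul_le_mul (hK _) (f.norm_coe_le_norm _) (norm_nonneg _)
      ((abs_nonneg _).trans (hK 0))
  calc ∫ v, k (S v) * f v ∂p
      = ∫ q, k q.1 * f (q.2 + T q.1) ∂(p.map (fun v => (S v, v - T (S v)))) := by
        rw [integral_map (S.continuous.prodMk hcont).aemeasurable hF.aestronglyMeasurable]
        simp
    _ = ∫ z, ∫ r, k z * f (r + T z) ∂(p.map (fun v => v - T (S v))) ∂(p.map S) := by
        rw [hprod, integral_prod _ hint]
    _ = _ := by
        refine integral_congr_ae (ae_of_all _ fun z => ?_)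
        have hfz : Continuous fun r => f (r + T z) := by fun_prop
        simp only
        rw [integral_const_mul, integral_map hcont.aemeasurable hfz.aestronglyMeasurable]
        rfl

/-- The weight of `z` as a value of `X s` under the prior. -/
def observationDensity (B₀ W : Matrix (Fin N) (Fin N) ℝ) (s : Fin N → ℝ)
    (z : EuclideanSpace ℝ (Fin N)) : ℝ :=
  gaussianDensity (applyCLM s (vect B₀)).ofLp (observationCov W s) z.ofLp

theorem continuous_observationDensity (B₀ W : Matrix (Fin N) (Fin N) ℝ) (s : Fin N → ℝ) :
    Continuous (observationDensity B₀ W s) :=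
  (continuous_gaussianDensity _ _).comp (PiLp.continuous_ofLp 2 _)

theorem observationDensity_nonneg (B₀ W : Matrix (Fin N) (Fin N) ℝ) (s : Fin N → ℝ)
    (z : EuclideanSpace ℝ (Fin N)) : 0 ≤ observationDensity B₀ W s z :=
  gaussianDensity_nonneg _ _ _

/-- Likelihood and density of X s exchange roles: the likelihood, read as a density in z, becomes
the measure N(y, L), which concentrates at y. -/
theorem integral_gaussianDensity_mul (B₀ : Matrix (Fin N) (Fin N) ℝ)
    {W : Matrix (Fin N) (Fin N) ℝ} (hW : IsDefinite W) {s : Fin N → ℝ} (hs : s ≠ 0)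
    (y : Fin N → ℝ) {L : Matrix (Fin N) (Fin N) ℝ} (hL : L.PosDef)
    (f : BoundedContinuousFunction (VecMat N) ℝ) :
    ∫ v, gaussianDensity (unvect v *ᵥ s) L y * f v ∂(matrixPrior B₀ W) =
      ∫ z, observationDensity B₀ W s z * conditionalMean B₀ W s f z
        ∂(multivariateGaussian (WithLp.toLp 2 y) L) := by
  have hk : Continuous fun z : EuclideanSpace ℝ (Fin N) => gaussianDensity y L z.ofLp :=
    (continuous_gaussianDensity _ _).comp (PiLp.continuous_ofLp 2 _)
  have h1 := integral_matrixPrior_eq B₀ hW hs hk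
    (fun z => (abs_of_nonneg (gaussianDensity_nonneg _ _ _)).le.trans (gaussianDensity_le y hL _)) f
  have h2 : ∀ v : VecMat N, gaussianDensity (unvect v *ᵥ s) L y =
      gaussianDensity y L (applyCLM s v).ofLp := fun v => gaussianDensity_comm _ _ _
  have hg : Measurable fun z : EuclideanSpace ℝ (Fin N) => ENNReal.ofReal
      (gaussianDensity (applyCLM s (vect B₀)).ofLp (observationCov W s) z.ofLp) :=
    (continuous_observationDensity B₀ W s).measurable.ennreal_ofReal
  simp_rw [h2]
  rw [h1, map_applyCLM_matrixPrior B₀ hW hs,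
    multivariateGaussian_eq_withDensity _ (posDef_observationCov hW hs),
    multivariateGaussian_eq_withDensity _ hL,
    integral_withDensity_eq_integral_toReal_smul
      hg (ae_of_all _ fun _ => ENNReal.ofReal_lt_top),
    integral_withDensity_eq_integral_toReal_smul hk.measurable.ennreal_ofReal
      (ae_of_all _ fun _ => ENNReal.ofReal_lt_top)]
  refine integral_congr_ae (ae_of_all _ fun z => ?_)
  simp only [smul_eq_mul, ENNReal.toReal_ofReal (gaussianDensity_nonneg _ _ _),
    observationDensity]
  ring

theorem integral_noisyPosterior (p : Measure (VecMat N)) (s y : Fin N → ℝ)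
    (L : Matrix (Fin N) (Fin N) ℝ) (f : VecMat N → ℝ) :
    ∫ v, f v ∂(noisyPosterior p s y L) =
      (∫ v, gaussianDensity (unvect v *ᵥ s) L y ∂p)⁻¹ *
        ∫ v, gaussianDensity (unvect v *ᵥ s) L y * f v ∂p := by
  have hc : Continuous fun v : VecMat N => gaussianDensity (unvect v *ᵥ s) L y := by
    simp_rw [gaussianDensity_comm _ L y, ← ofLp_applyCLM]
    exact (continuous_gaussianDensity _ _).comp
      ((PiLp.continuous_ofLp 2 _).comp (applyCLM s).continuous)
  have hlik : Measurable (likelihood s y L) := hc.measurable.ennreal_ofReal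
  rw [noisyPosterior, integral_smul_measure, integral_withDensity_eq_integral_toReal_smul
    hlik (ae_of_all _ fun _ => ENNReal.ofReal_lt_top),
    integral_eq_lintegral_of_nonneg_ae (ae_of_all _ fun _ => gaussianDensity_nonneg _ _ _)
      hc.aestronglyMeasurable, ENNReal.toReal_inv, smul_eq_mul]
  simp only [likelihood, ENNReal.toReal_ofReal (gaussianDensity_nonneg _ _ _), smul_eq_mul]

theorem isNoiseFreePosterior_conditionedPrior (B₀ : Matrix (Fin N) (Fin N) ℝ)
    {W : Matrix (Fin N) (Fin N) ℝ} (hW : IsDefinite W) {s : Fin N → ℝ} (hs : s ≠ 0)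
    (y : Fin N → ℝ) :
    IsNoiseFreePosterior (matrixPrior B₀ W) s y (conditionedPrior B₀ W s y) := by
  refine ⟨inferInstance, fun f => ?_⟩
  have hg := continuous_observationDensity B₀ W s
  have hgpos : 0 < observationDensity B₀ W s (WithLp.toLp 2 y) :=
    gaussianDensity_pos _ (posDef_observationCov hW hs) _
  have hlim : ∀ f : BoundedContinuousFunction (VecMat N) ℝ,
      Tendsto (fun L : Matrix (Fin N) (Fin N) ℝ =>
        ∫ v, gaussianDensity (unvect v *ᵥ s) L y * f v ∂(matrixPrior B₀ W))
        (𝓝[{L | L.PosDef}] 0) (𝓝 (observationDensity B₀ W s (WithLp.toLp 2 y) *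
          conditionalMean B₀ W s f (WithLp.toLp 2 y))) := by
    intro f
    have h := tendsto_integral_multivariateGaussian (WithLp.toLp 2 y)
      (hg.mul (continuous_conditionalMean B₀ W s f))
      (K := (Real.sqrt ((2 * Real.pi) ^ N * (observationCov W s).det))⁻¹ * ‖f‖) fun z => by
        rw [Pi.mul_apply, abs_mul, abs_of_nonneg (observationDensity_nonneg B₀ W s z)]
        exact mul_le_mul (gaussianDensity_le _ (posDef_observationCov hW hs) _)
          (abs_conditionalMean_le B₀ W s f z) (abs_nonneg _) (by positivity)
    refine h.congr' ?_
    filter_upwards [self_mem_nhdsWithin] with L hL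
    exact (integral_gaussianDensity_mul B₀ hW hs y hL f).symm
  -- The case f = 1 is the evidence, whose limit is the positive density at y.
  have hone := hlim 1
  have hmean_one : conditionalMean B₀ W s (1 : BoundedContinuousFunction (VecMat N) ℝ)
      (WithLp.toLp 2 y) = 1 := by simp [conditionalMean]
  rw [hmean_one, mul_one] at hone
  simp only [BoundedContinuousFunction.coe_one, Pi.one_apply, mul_one] at hone
  have h := (hone.inv₀ hgpos.ne').mul (hlim f)
  rw [inv_mul_cancel_left₀ hgpos.ne'] at h
  have hq : ∫ v, f v ∂(conditionedPrior B₀ W s y) =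
      conditionalMean B₀ W s f (WithLp.toLp 2 y) :=
    integral_map (continuous_conditionTo _ _ _).aemeasurable f.continuous.aestronglyMeasurable
  simp_rw [integral_noisyPosterior, hq]
  exact h

/-- The one-step posterior mean for a definite `W` is the Dennis update with parameter `W s`. -/
theorem isOneStepPosteriorMean_dennisUpdate (B₀ : Matrix (Fin N) (Fin N) ℝ)
    {W : Matrix (Fin N) (Fin N) ℝ} (hW : IsDefinite W) {s : Fin N → ℝ} (hs : s ≠ 0)
    (y : Fin N → ℝ) :
    IsOneStepPosteriorMean B₀ W s y (dennisUpdate B₀ s y (W *ᵥ s)) := by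
  refine ⟨hW.posSemidef_symKron, conditionedPrior B₀ W s y,
    isNoiseFreePosterior_conditionedPrior B₀ hW hs y, ?_, integral_id_conditionedPrior B₀ W s y⟩
  exact (integrable_map_measure aestronglyMeasurable_id
    (continuous_conditionTo _ _ _).aemeasurable).2 (integrable_conditionTo B₀ W s _ _)

/-! ### Scaling, freedom and global uniqueness of the prior parameter. -/

theorem dennisUpdate_smul (B₀ : Matrix (Fin N) (Fin N) ℝ) (s y c : Fin N → ℝ) {a : ℝ}
    (ha : a ≠ 0) : dennisUpdate B₀ s y (a • c) = dennisUpdate B₀ s y c := by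
  have h1 : (a * (c ⬝ᵥ s))⁻¹ * a = (c ⬝ᵥ s)⁻¹ := by
    rw [mul_inv, mul_right_comm, inv_mul_cancel₀ ha, one_mul]
  have h2 : (s ⬝ᵥ (y - B₀ *ᵥ s)) / (a * (c ⬝ᵥ s)) ^ 2 * (a * a) =
      (s ⬝ᵥ (y - B₀ *ᵥ s)) / (c ⬝ᵥ s) ^ 2 := by
    rw [mul_pow, ← sq, div_mul_eq_mul_div, mul_comm (a ^ 2), mul_div_mul_right _ _ (pow_ne_zero 2 ha)]
  simp only [dennisUpdate, smul_dotProduct, smul_eq_mul, vecMulVec_smul, smul_vecMulVec, smul_smul,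
    ← smul_add, h1, h2]

theorem isOneStepPosteriorMean_smul (B₀ : Matrix (Fin N) (Fin N) ℝ)
    {W : Matrix (Fin N) (Fin N) ℝ} (hW : IsDefinite W) {s c : Fin N → ℝ} (hs : s ≠ 0)
    (hc : W *ᵥ s = c) (y : Fin N → ℝ) {a : ℝ} (ha : a ≠ 0) :
    IsOneStepPosteriorMean B₀ (a • W) s y (dennisUpdate B₀ s y c) := by
  have h := isOneStepPosteriorMean_dennisUpdate B₀ (hW.smul ha) hs y
  rwa [smul_mulVec, hc, dennisUpdate_smul B₀ s y c ha] at h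

theorem choices_eq_mk' {V : Matrix (Fin N) (Fin N) ℝ} (hV : V.IsSymm) (s : Fin N → ℝ) :
    choices s (V *ᵥ s) =
      (AffineSubspace.mk' V (annihilators s) : Set (Matrix (Fin N) (Fin N) ℝ)) := by
  ext W
  rw [SetLike.mem_coe, AffineSubspace.mem_mk', vsub_eq_sub]
  constructor
  · rintro ⟨h1, h2⟩
    exact ⟨h1.sub hV, by rw [sub_mulVec, h2, sub_self]⟩
  · rintro ⟨h1, h2⟩
    refine ⟨by simpa using h1.add hV, ?_⟩
    rwa [sub_mulVec, sub_eq_zero] at h2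

theorem exists_ne_zero_dotProduct_eq_zero (hN : 2 ≤ N) (s : Fin N → ℝ) :
    ∃ v : Fin N → ℝ, v ≠ 0 ∧ v ⬝ᵥ s = 0 := by
  set i : Fin N := ⟨0, by omega⟩
  set j : Fin N := ⟨1, by omega⟩
  have hij : i ≠ j := by simp [i, j, Fin.ext_iff]
  by_cases h : s i = 0
  · exact ⟨Pi.single i 1, by simp, by simp [h]⟩
  · refine ⟨Pi.single j (s i) - Pi.single i (s j), fun h0 => h ?_, ?_⟩
    · simpa [hij.symm] using congrFun h0 j
    · rw [sub_dotProduct, single_dotProduct, single_dotProduct]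
      ring

/-- Perturb V by ± v vᵀ with v ≠ 0 orthogonal to s; taking the sign of V keeps it definite. -/
theorem exists_isDefinite_mem_choices_ne (hN : 2 ≤ N) {V : Matrix (Fin N) (Fin N) ℝ}
    (hV : IsDefinite V) (s : Fin N → ℝ) :
    ∃ W ∈ choices s (V *ᵥ s), IsDefinite W ∧ W ≠ V := by
  obtain ⟨v, hv, hvs⟩ := exists_ne_zero_dotProduct_eq_zero hN s
  have hpsd : (vecMulVec v v).PosSemidef := by simpa using posSemidef_vecMulVec_self_star v
  have hsymm : (vecMulVec v v).IsSymm := transpose_vecMulVec v v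
  have hne : vecMulVec v v ≠ 0 := by
    obtain ⟨i, hi⟩ := Function.ne_iff.1 hv
    intro h
    have := congrFun (congrFun h i) i
    simp [vecMulVec_apply] at this
    exact hi this
  have hzero : vecMulVec v v *ᵥ s = 0 := by simp [vecMulVec_mulVec, hvs]
  rcases id hV with h | h
  · refine ⟨V + vecMulVec v v, ⟨hV.isSymm.add hsymm, ?_⟩, Or.inl (h.add_posSemidef hpsd), ?_⟩
    · rw [add_mulVec, hzero, add_zero]
    · simpa using hne
  · refine ⟨V - vecMulVec v v, ⟨hV.isSymm.sub hsymm, ?_⟩, Or.inr ?_, ?_⟩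
    · rw [sub_mulVec, hzero, sub_zero]
    · rw [neg_sub, sub_eq_neg_add]
      exact h.add_posSemidef hpsd
    · simpa using hne

theorem IsDefinite.isUnit_det {V : Matrix (Fin N) (Fin N) ℝ} (hV : IsDefinite V) :
    IsUnit V.det := by
  rw [← isUnit_iff_isUnit_det]
  rcases hV with h | h
  · exact h.isUnit
  · simpa using h.isUnit.neg

theorem forall_exists_mulVec_eq_smul_iff {V : Matrix (Fin N) (Fin N) ℝ} (hV : IsUnit V.det)
    (W : Matrix (Fin N) (Fin N) ℝ) :
    (∀ v, ∃ a : ℝ, W *ᵥ v = a • (V *ᵥ v)) ↔ ∃ a : ℝ, W = a • V := by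
  constructor
  · intro h
    -- Substituting v = V⁻¹ u shows that u and W V⁻¹ u are always dependent, which forces W V⁻¹ to
    -- be scalar.
    obtain ⟨a, ha⟩ := LinearMap.exists_eq_smul_id_of_forall_notLinearIndependent
      (f := (W * V⁻¹).mulVecLin) fun u => by
        obtain ⟨a, ha⟩ := h (V⁻¹ *ᵥ u)
        rw [mulVec_mulVec, mulVec_mulVec, mul_nonsing_inv _ hV, one_mulVec] at ha
        intro hli
        have := LinearIndependent.pair_iff.1 hli a (-1) (by simp [ha])
        simp at this
    refine ⟨a, ?_⟩
    have h1 : W * V⁻¹ = a • 1 := by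
      apply Matrix.toLin'.injective
      rw [map_smul, toLin'_one]
      exact ha
    rw [← mul_one W, ← nonsing_inv_mul V hV, ← Matrix.mul_assoc, h1, Matrix.smul_mul, one_mul]
  · rintro ⟨a, rfl⟩ v
    exact ⟨a, smul_mulVec _ _ _⟩

theorem isUniqueGlobalChoice_of_isDefinite (B₀ : Matrix (Fin N) (Fin N) ℝ)
    {V : Matrix (Fin N) (Fin N) ℝ} (hV : IsDefinite V) {s : Fin N → ℝ} (hs : s ≠ 0)
    (y : Fin N → ℝ) {c : (Fin N → ℝ) → (Fin N → ℝ)} (hc : ∀ v, c v = V *ᵥ v) :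
    IsUniqueGlobalChoice B₀ V c s y (dennisUpdate B₀ s y (c s)) := by
  obtain rfl : c = fun v => V *ᵥ v := funext hc
  refine ⟨choices_eq_mk' hV.isSymm s, fun hN => exists_isDefinite_mem_choices_ne hN hV s,
    fun W hW hWd a ha => isOneStepPosteriorMean_smul B₀ hWd hs hW.2 y ha, fun W => ?_,
    fun W => forall_exists_mulVec_eq_smul_iff hV.isUnit_det W⟩
  exact ⟨fun h => Matrix.ext_of_mulVec_single fun i => h _, fun h v => by rw [h]⟩

end SecantInference

end

theorem corollary3p1 (N : ℕ) (B B₀ : Matrix (Fin N) (Fin N) ℝ) (hB : B.PosDef)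
    (hB₀ : B₀.IsSymm) (s : Fin N → ℝ) (hs : s ≠ 0) :
    -- Powell symmetric Broyden
    (∀ α : ℝ, α ≠ 0 →
      IsOneStepPosteriorMean B₀ (α • (1 : Matrix (Fin N) (Fin N) ℝ)) s (B *ᵥ s)
        (psbUpdate B₀ s (B *ᵥ s))) ∧
    -- symmetric rank 1
    (IsDefinite (B - B₀) →
      (∀ α : ℝ, α ≠ 0 →
        IsOneStepPosteriorMean B₀ (α • (B - B₀)) s (B *ᵥ s) (sr1Update B₀ s (B *ᵥ s))) ∧
      IsUniqueGlobalChoice B₀ (B - B₀) (fun v => B *ᵥ v - B₀ *ᵥ v) s (B *ᵥ s)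
        (sr1Update B₀ s (B *ᵥ s))) ∧
    -- Greenstadt
    (IsDefinite B₀ →
      ∀ α : ℝ, α ≠ 0 →
        IsOneStepPosteriorMean B₀ (α • B₀) s (B *ᵥ s) (greenstadtUpdate B₀ s (B *ᵥ s))) ∧
    -- Davidon, Fletcher, Powell
    ((∀ α : ℝ, α ≠ 0 →
        IsOneStepPosteriorMean B₀ (α • B) s (B *ᵥ s) (dfpUpdate B₀ s (B *ᵥ s))) ∧
      IsUniqueGlobalChoice B₀ B (fun v => B *ᵥ v) s (B *ᵥ s) (dfpUpdate B₀ s (B *ᵥ s))) ∧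
    -- Broyden, Fletcher, Goldfarb, Shanno
    (∀ ρ : ℝ, ρ = Real.sqrt ((s ⬝ᵥ (B *ᵥ s)) / (s ⬝ᵥ (B₀ *ᵥ s))) →
      0 < s ⬝ᵥ (B₀ *ᵥ s) → IsDefinite (B + ρ • B₀) →
      (∀ α : ℝ, α ≠ 0 →
        IsOneStepPosteriorMean B₀ (α • (B + ρ • B₀)) s (B *ᵥ s) (bfgsUpdate B₀ s (B *ᵥ s))) ∧
      IsUniqueGlobalChoice B₀ (B + ρ • B₀) (fun v => B *ᵥ v + ρ • (B₀ *ᵥ v)) s (B *ᵥ s)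
        (bfgsUpdate B₀ s (B *ᵥ s))) := by
  have hBd : IsDefinite B := Or.inl hB
  have hy : B *ᵥ s - B₀ *ᵥ s = (B - B₀) *ᵥ s := (sub_mulVec _ _ _).symm
  refine ⟨fun α hα => ?_, fun hd => ⟨fun α hα => ?_, ?_⟩, fun hd α hα => ?_,
    ⟨fun α hα => ?_, ?_⟩, fun ρ hρ _ hd => ?_⟩
  · exact isOneStepPosteriorMean_smul B₀ (Or.inl PosDef.one) hs (one_mulVec s) _ hα
  · exact isOneStepPosteriorMean_smul B₀ hd hs hy.symm _ hα
  · exact isUniqueGlobalChoice_of_isDefinite B₀ hd hs _ fun v => (sub_mulVec _ _ _).symm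
  · exact isOneStepPosteriorMean_smul B₀ hd hs rfl _ hα
  · exact isOneStepPosteriorMean_smul B₀ hBd hs rfl _ hα
  · exact isUniqueGlobalChoice_of_isDefinite B₀ hBd hs _ fun _ => rfl
  · have hc : ∀ v, B *ᵥ v + ρ • (B₀ *ᵥ v) = (B + ρ • B₀) *ᵥ v := fun v => by
      rw [add_mulVec, smul_mulVec]
    -- With y = B s, the square root in the update rule is ρ, so its parameter vector is (B + ρ B₀)
    -- s.
    have hA : bfgsUpdate B₀ s (B *ᵥ s) =
        dennisUpdate B₀ s (B *ᵥ s) (B *ᵥ s + ρ • (B₀ *ᵥ s)) := by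
      rw [bfgsUpdate, hρ, dotProduct_comm (B *ᵥ s) s]
    rw [hA]
    exact ⟨fun α hα => isOneStepPosteriorMean_smul B₀ hd hs (hc s).symm _ hα,
      isUniqueGlobalChoice_of_isDefinite B₀ hd hs _ hc⟩
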